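/- Let $\mathcal F$ be a signature (a set of function symbols, each with a fixed arity) and $\mathcal V$ a countably infinite set of variables. Let a sort attachment with set of sorts $S$ be given, that is, a type $f:\alpha_1\times\cdots\times\alpha_n\to\alpha$ with $\alpha_i,\alpha\in S$ for each $n$-ary $f\in\mathcal F$, and a sort in $S$ for each variable, such that for each $\alpha\in S$ the set $\mathcal V_\alpha$ of variables of sort $\alpha$ is countably infinite. Let the sets $\mathcal T_\alpha$ of terms of sort $\alpha$ be defined inductively by $$\mathcal T_\alpha=\mathcal V_\alpha\cup\{f(t_1,\dots,t_n)\mid f:\alpha_1\times\cdots\times\alpha_n\to\alpha \text{ and } t_i\in\mathcal T_{\alpha_i}\text{ for } 1\le i\le n\},$$ and let $\mathcal T_{\mathrm{ms}}=\bigcup_{\alpha\in S}\mathcal T_\alpha$ be the set of many-sorted terms. Let $\mathcal R$ be a term rewrite system over $\mathcal F$ and $\mathcal V$, that is, a set of rules $\ell\to r$ between terms such that $\ell$ is not a variable and every variable of $r$ occurs in $\ell$; let $\to_{\mathcal R}$ be its rewrite relation on the set of all (unsorted) terms $\mathcal T(\mathcal F,\mathcal V)$. A relation $\to$ is confluent if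 $t\mathrel{{}^*\!\leftarrow} s\to^* u$ always implies $t\to^* v\mathrel{{}^*\!\leftarrow} u$ for some $v$; it is confluent on a set $T$ if $T$ is closed under $\to$ and ${\to}\cap(T\times T)$ is confluent. **Theorem.** Suppose that $\mathcal R$ is compatible with the sort attachment, i.e. for each rule $\ell\to r\in\mathcal R$ there is $\alpha\in S$ with $\ell,r\in\mathcal T_\alpha$. If $\to_{\mathcal R}$ is confluent on $\mathcal T_{\mathrm{ms}}$, then $\to_{\mathcal R}$ is confluent on the set of all terms $\mathcal T(\mathcal F,\mathcal V)$. -/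

import Mathlib

/-!
Every term is regarded in a slot of some sort `β`: it splits into a well-sorted cap and the maximal
subterms whose root symbol does not fit, its aliens. Rewriting never increases the number of nested
layers, so one argues by induction on this rank, and aliens may be assumed to be confluent. Suppose
first that no alien can collapse into the cap around it. Replacing aliens by variables, one for each
sort and joinability class, then turns every step into a joinable pair of sorted terms, so
confluence of the sorted terms makes the abstractions of two reducts joinable; substituting common
reducts for the variables transfers this back. For arbitrary aliens, choose for each one a reduct
whose own aliens no longer collapse, which exists because a collapse lowers the rank. Replacing all
aliens by the chosen reducts maps a step to a joinable pair of confluent terms, so the images of two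
reducts of one term are joinable.
-/

universe u v w z

namespace TermRewriting

/- A signature (function symbols with fixed arities) is the family of function symbols of a
first-order language `L`; relation symbols of `L` do not occur in terms and play no role.
The terms over the signature and the variables `V` are `L.Term V`, and the homomorphic
extension of a substitution `σ : V → L.Term V` to terms is `fun t => t.subst σ`. -/

/-- A term rewrite system: a set of rules `(ℓ, r)` such that `ℓ` is not a variable and every
variable of `r` occurs in `ℓ`. -/
structure TRS (L : FirstOrder.Language.{u, v}) (V : Type w) where
  rules : Set (L.Term V × L.Term V)
  lhs_not_var : ∀ ℓ r, (ℓ, r) ∈ rules → ∀ x : V, ℓ ≠ FirstOrder.Language.Term.var x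
  vars_subset : open Classical in ∀ ℓ r, (ℓ, r) ∈ rules → r.varFinset ⊆ ℓ.varFinset

/-- The rewrite relation of a term rewrite system: contract one instance of a left-hand side
at the root or inside one argument. -/
inductive TRS.Step {L : FirstOrder.Language.{u, v}} {V : Type w} (R : TRS L V) :
    L.Term V → L.Term V → Prop
  | root (ℓ r : L.Term V) (h : (ℓ, r) ∈ R.rules) (σ : V → L.Term V) :
      TRS.Step R (ℓ.subst σ) (r.subst σ)
  | arg {n : ℕ} (f : L.Functions n) (ts : Fin n → L.Term V) (i : Fin n) (t : L.Term V)
      (h : TRS.Step R (ts i) t) :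
      TRS.Step R (FirstOrder.Language.Term.func f ts) (FirstOrder.Language.Term.func f (Function.update ts i t))

/-- Confluence of a binary relation: any two reducts of a common element are joinable. -/
def Confluent {α : Type*} (r : α → α → Prop) : Prop :=
  ∀ s t u, Relation.ReflTransGen r s t → Relation.ReflTransGen r s u →
    ∃ v, Relation.ReflTransGen r t v ∧ Relation.ReflTransGen r u v

/-- `r` is confluent on `T` if `T` is closed under `r` and the restriction of `r` to `T × T`
is confluent. -/
def ConfluentOn {α : Type*} (r : α → α → Prop) (T : Set α) : Prop :=
  (∀ s ∈ T, ∀ t, r s t → t ∈ T) ∧ Confluent (fun s t => s ∈ T ∧ t ∈ T ∧ r s t)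

/-- A many-sorted sort attachment with sorts `S`: every `n`-ary function symbol `f` gets a type
`argSort f 0 × ⋯ × argSort f (n - 1) → resSort f` and every variable gets a sort, such that
there are countably infinitely many variables of each sort. -/
structure SortAttachment (L : FirstOrder.Language.{u, v}) (V : Type w) (S : Type z) where
  argSort : ∀ {n : ℕ}, L.Functions n → Fin n → S
  resSort : ∀ {n : ℕ}, L.Functions n → S
  varSort : V → S
  vars_countable : ∀ α : S, {x : V | varSort x = α}.Countable
  vars_infinite : ∀ α : S, {x : V | varSort x = α}.Infinite

/-- `A.HasSort t α`: the term `t` is well-sorted, of sort `α`. -/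
inductive SortAttachment.HasSort {L : FirstOrder.Language.{u, v}} {V : Type w} {S : Type z}
    (A : SortAttachment L V S) : L.Term V → S → Prop
  | var (x : V) : SortAttachment.HasSort A (FirstOrder.Language.Term.var x) (A.varSort x)
  | func {n : ℕ} (f : L.Functions n) (ts : Fin n → L.Term V)
      (h : ∀ i, SortAttachment.HasSort A (ts i) (A.argSort f i)) :
      SortAttachment.HasSort A (FirstOrder.Language.Term.func f ts) (A.resSort f)

/-- The set of many-sorted terms: the union over all sorts `α` of the terms of sort `α`. -/
def SortAttachment.sortedTerms {L : FirstOrder.Language.{u, v}} {V : Type w} {S : Type z}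
    (A : SortAttachment L V S) : Set (L.Term V) :=
  {t | ∃ α : S, A.HasSort t α}

/-- `R` is compatible with `A` if both sides of each rule have a common sort. -/
def TRS.Compatible {L : FirstOrder.Language.{u, v}} {V : Type w} {S : Type z}
    (R : TRS L V) (A : SortAttachment L V S) : Prop :=
  ∀ ℓ r, (ℓ, r) ∈ R.rules → ∃ α : S, A.HasSort ℓ α ∧ A.HasSort r α

end TermRewriting

namespace TermRewriting

open FirstOrder.Language Relation

section AbstractRewriting

variable {α : Type*} {r : α → α → Prop} {a b c : α}

/-- Joinability `a ↓ b`: the elements `a` and `b` have a common reduct. -/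
abbrev Joinable (r : α → α → Prop) : α → α → Prop :=
  Join (ReflTransGen r)

/-- Confluence of the single element `a`: any two reducts of `a` are joinable. -/
def ConfluentAt (r : α → α → Prop) (a : α) : Prop :=
  ∀ b c, ReflTransGen r a b → ReflTransGen r a c → Joinable r b c

theorem Joinable.refl (a : α) : Joinable r a a :=
  ⟨a, .refl, .refl⟩

theorem Joinable.symm : Joinable r a b → Joinable r b a
  | ⟨c, hac, hbc⟩ => ⟨c, hbc, hac⟩

theorem Joinable.of_reduces (h : ReflTransGen r a b) : Joinable r a b :=
  ⟨b, h, .refl⟩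

theorem Joinable.of_reduces_of_reduces {a' b' : α} (ha : ReflTransGen r a a')
    (hb : ReflTransGen r b b') : Joinable r a' b' → Joinable r a b
  | ⟨c, hac, hbc⟩ => ⟨c, ha.trans hac, hb.trans hbc⟩

theorem Joinable.map {β : Type*} {p : β → β → Prop} (f : α → β)
    (hf : ∀ a b, r a b → p (f a) (f b)) : Joinable r a b → Joinable p (f a) (f b)
  | ⟨c, hac, hbc⟩ => ⟨f c, hac.lift f hf, hbc.lift f hf⟩

namespace ConfluentAt

theorem joinable_trans (hb : ConfluentAt r b) (hab : Joinable r a b) (hbc : Joinable r b c) :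
    Joinable r a c := by
  obtain ⟨d, had, hbd⟩ := hab
  obtain ⟨e, hbe, hce⟩ := hbc
  exact (hb d e hbd hbe).of_reduces_of_reduces had hce

theorem of_reduces (ha : ConfluentAt r a) (h : ReflTransGen r a b) : ConfluentAt r b :=
  fun c d hc hd => ha c d (h.trans hc) (h.trans hd)

theorem joinable_congr_left (ha : ConfluentAt r a) (h : ReflTransGen r a b) :
    Joinable r a c ↔ Joinable r b c :=
  ⟨ha.joinable_trans (Joinable.of_reduces h).symm, Joinable.of_reduces_of_reduces h .refl⟩

end ConfluentAt

theorem ConfluentOn.confluentAt {T : Set α} (h : ConfluentOn r T) (ha : a ∈ T) :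
    ConfluentAt r a := by
  have restrict {b : α} (hab : ReflTransGen r a b) :
      b ∈ T ∧ ReflTransGen (fun s t => s ∈ T ∧ t ∈ T ∧ r s t) a b := by
    induction hab with
    | refl => exact ⟨ha, .refl⟩
    | tail _ hbc ih =>
      have hc := h.1 _ ih.1 _ hbc
      exact ⟨hc, ih.2.tail ⟨ih.1, hc, hbc⟩⟩
  intro b c hab hac
  obtain ⟨d, hbd, hcd⟩ := h.2 a b c (restrict hab).2 (restrict hac).2
  exact ⟨d, hbd.lift id fun _ _ hst => hst.2.2, hcd.lift id fun _ _ hst => hst.2.2⟩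

theorem joinable_map_of_reduces {β : Type*} {p : β → β → Prop} (T : α → β)
    (hconf : ∀ b, ReflTransGen r a b → ConfluentAt p (T b))
    (hstep : ∀ b c, ReflTransGen r a b → r b c → Joinable p (T b) (T c))
    (hab : ReflTransGen r a b) (hac : ReflTransGen r a c) : Joinable p (T b) (T c) := by
  have from_source {d : α} (had : ReflTransGen r a d) : Joinable p (T a) (T d) := by
    induction had with
    | refl => exact .refl _
    | tail had hde ih => exact (hconf _ had).joinable_trans ih (hstep _ _ had hde)
  exact (hconf a .refl).joinable_trans (from_source hab).symm (from_source hac)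

theorem exists_common_reduct [Nonempty α] {F : Set α} (hF : F.Finite)
    (hconf : ∀ a ∈ F, ConfluentAt r a) (hjoin : ∀ a ∈ F, ∀ b ∈ F, Joinable r a b) :
    ∃ c, ∀ a ∈ F, ReflTransGen r a c := by
  induction F, hF using Set.Finite.induction_on with
  | empty => simp
  | @insert a F _ _ ih =>
    simp only [Set.forall_mem_insert] at hconf hjoin ⊢
    obtain ⟨c, hc⟩ := ih hconf.2 fun b hb => (hjoin.2 b hb).2
    rcases F.eq_empty_or_nonempty with rfl | ⟨b, hb⟩
    · exact ⟨a, .refl, by simp⟩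
    · obtain ⟨d, had, hcd⟩ :=
        (hconf.2 b hb).joinable_trans (hjoin.1.2 b hb) (.of_reduces (hc b hb))
      exact ⟨d, had, fun b hb => (hc b hb).trans hcd⟩

theorem exists_common_reduct_on_fibers [Nonempty α] {ι κ : Type*} {H : Set ι} (hH : H.Finite)
    (f : ι → α) (k : ι → κ) (hconf : ∀ i ∈ H, ConfluentAt r (f i))
    (hjoin : ∀ i ∈ H, ∀ j ∈ H, k i = k j → Joinable r (f i) (f j)) :
    ∃ w : κ → α, ∀ i ∈ H, ReflTransGen r (f i) (w (k i)) := by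
  have fiber (x : κ) : ∃ c, ∀ a ∈ f '' {i ∈ H | k i = x}, ReflTransGen r a c := by
    refine exists_common_reduct ((hH.subset (Set.sep_subset _ _)).image f) ?_ ?_
    · rintro _ ⟨i, hi, rfl⟩
      exact hconf i hi.1
    · rintro _ ⟨i, hi, rfl⟩ _ ⟨j, hj, rfl⟩
      exact hjoin i hi.1 j hj.1 (hi.2.trans hj.2.symm)
  choose w hw using fiber
  exact ⟨w, fun i hi => hw (k i) (f i) ⟨i, ⟨hi, rfl⟩, rfl⟩⟩

end AbstractRewriting

variable {L : FirstOrder.Language.{u, v}} {V : Type w} {S : Type z}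

section Substitution

variable {α β γ : Type*}

theorem subst_subst (t : L.Term α) (σ : α → L.Term β) (τ : β → L.Term γ) :
    (t.subst σ).subst τ = t.subst fun x => (σ x).subst τ := by
  induction t with
  | var x => rfl
  | func f ts ih => exact congrArg (Term.func f) (funext ih)

theorem mem_varFinset_func [DecidableEq α] {n : ℕ} {f : L.Functions n} {ts : Fin n → L.Term α}
    {x : α} : x ∈ (Term.func f ts).varFinset ↔ ∃ i, x ∈ (ts i).varFinset := by
  simp only [Term.varFinset, Finset.mem_biUnion, Finset.mem_univ, true_and]

theorem mem_varFinset_subst [DecidableEq α] [DecidableEq β] {t : L.Term α}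
    {σ : α → L.Term β} {y : β} :
    y ∈ (t.subst σ).varFinset ↔ ∃ x ∈ t.varFinset, y ∈ (σ x).varFinset := by
  induction t with
  | var x => simp only [Term.subst, Term.varFinset, Finset.mem_singleton, exists_eq_left]
  | func f ts ih =>
    simp only [Term.subst, mem_varFinset_func, ih]
    exact ⟨fun ⟨i, x, hx, hy⟩ => ⟨x, ⟨i, hx⟩, hy⟩, fun ⟨x, ⟨i, hx⟩, hy⟩ => ⟨i, x, hx, hy⟩⟩

end Substitution

namespace TRS

variable {R : TRS L V}

theorem Step.subst {s t : L.Term V} (h : R.Step s t) (τ : V → L.Term V) :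
    R.Step (s.subst τ) (t.subst τ) := by
  induction h with
  | root ℓ r h σ =>
    rw [subst_subst, subst_subst]
    exact .root ℓ r h _
  | arg f ts i t _ ih =>
    have := Step.arg f (fun j => (ts j).subst τ) i (t.subst τ) ih
    simpa only [Term.subst, Function.apply_update fun _ (u : L.Term V) => u.subst τ] using this

theorem eq_var_of_reduces {x : V} {t : L.Term V} (h : ReflTransGen R.Step (.var x) t) :
    t = .var x := by
  have irreducible (t : L.Term V) : ¬ R.Step (.var x) t := by
    intro h
    generalize hs : (Term.var x : L.Term V) = s at h
    cases h with
    | root ℓ r h σ =>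
      cases ℓ with
      | var y => exact R.lhs_not_var _ _ h y rfl
      | func f ts => cases hs
    | arg => cases hs
  rcases h.cases_head with h | ⟨u, h, -⟩
  · exact h.symm
  · exact absurd h (irreducible u)

theorem confluentAt_var (x : V) : ConfluentAt R.Step (.var x) := by
  intro t u ht hu
  rw [eq_var_of_reduces ht, eq_var_of_reduces hu]
  exact .refl _

theorem reduces_func_update {n : ℕ} (f : L.Functions n) {ts : Fin n → L.Term V} {i : Fin n}
    {t : L.Term V} (h : ReflTransGen R.Step (ts i) t) :
    ReflTransGen R.Step (.func f ts) (.func f (Function.update ts i t)) := by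
  suffices ReflTransGen R.Step (.func f (Function.update ts i (ts i)))
      (.func f (Function.update ts i t)) by rwa [Function.update_eq_self] at this
  refine h.lift (fun u => Term.func f (Function.update ts i u)) fun u u' huu' => ?_
  simpa only [Function.update_idem] using
    Step.arg f (Function.update ts i u) i u' (by rwa [Function.update_self])

theorem joinable_func_update {n : ℕ} (f : L.Functions n) {ts : Fin n → L.Term V} {i : Fin n}
    {t : L.Term V} (h : Joinable R.Step (ts i) t) :
    Joinable R.Step (.func f ts) (.func f (Function.update ts i t)) := by
  obtain ⟨u, hu, htu⟩ := h
  refine ⟨.func f (Function.update ts i u), reduces_func_update f hu, ?_⟩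
  have := reduces_func_update f (ts := Function.update ts i t) (i := i) (t := u)
    (by rwa [Function.update_self])
  rwa [Function.update_idem] at this

theorem reduces_func {n : ℕ} (f : L.Functions n) {ts us : Fin n → L.Term V}
    (h : ∀ i, ReflTransGen R.Step (ts i) (us i)) :
    ReflTransGen R.Step (.func f ts) (.func f us) := by
  have partially (I : Finset (Fin n)) :
      ReflTransGen R.Step (.func f ts) (.func f (I.piecewise us ts)) := by
    induction I using Finset.induction_on with
    | empty => rw [Finset.piecewise_empty]
    | insert i I hi ih =>
      rw [Finset.piecewise_insert]
      refine ih.trans (reduces_func_update f ?_)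
      rw [Finset.piecewise_eq_of_notMem _ _ _ hi]
      exact h i
  simpa only [Finset.piecewise_univ] using partially Finset.univ

theorem reduces_subst {α : Type*} [DecidableEq α] (t : L.Term α) {σ τ : α → L.Term V}
    (h : ∀ x ∈ t.varFinset, ReflTransGen R.Step (σ x) (τ x)) :
    ReflTransGen R.Step (t.subst σ) (t.subst τ) := by
  induction t with
  | var x => exact h x (Finset.mem_singleton_self x)
  | func f ts ih =>
    exact reduces_func f fun i => ih i fun x hx => h x (mem_varFinset_func.2 ⟨i, hx⟩)

end TRS

namespace SortAttachment

section Caps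

variable (A : SortAttachment L V S)

/-- The result sort of the root symbol. Variables have no root sort, so that they are aliens in
every slot. -/
def rootSort : L.Term V → Option S
  | .var _ => none
  | .func f _ => some (A.resSort f)

variable {A} in
theorem HasSort.rootSort_subst {p : L.Term V} {α : S} (hp : A.HasSort p α)
    (hvar : ∀ x, p ≠ .var x) (σ : V → L.Term V) : A.rootSort (p.subst σ) = some α := by
  cases hp with
  | var x => exact absurd rfl (hvar x)
  | func => rfl

@[elab_as_elim]
theorem slot_induction {motive : S → L.Term V → Prop}
    (alien : ∀ β s, A.rootSort s ≠ some β → motive β s)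
    (func : ∀ {n : ℕ} (f : L.Functions n) (ts : Fin n → L.Term V),
      (∀ i, motive (A.argSort f i) (ts i)) → motive (A.resSort f) (.func f ts))
    (β : S) (s : L.Term V) : motive β s := by
  induction s generalizing β with
  | var x => exact alien β _ nofun
  | func f ts ih =>
    by_cases hβ : A.rootSort (.func f ts) = some β
    · cases hβ
      exact func f ts fun i => ih i _
    · exact alien β _ hβ

open Classical in
/-- The cap of a term that stands in a slot of sort `β`: its largest well-sorted top part. Each
hole is a variable labelled with the sort of the hole and with the alien filling it, so the term
itself is recovered by the substitution `Prod.snd`. -/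
noncomputable def cap : S → L.Term V → L.Term (S × L.Term V)
  | β, .var x => .var (β, .var x)
  | β, .func f ts =>
    if A.resSort f = β then .func f fun i => cap (A.argSort f i) (ts i)
    else .var (β, .func f ts)

open Classical in
/-- The aliens of a term that stands in a slot of sort `β`, each paired with the sort of the hole
of the cap that it fills. -/
noncomputable def aliens (β : S) (s : L.Term V) : Finset (S × L.Term V) :=
  (A.cap β s).varFinset

theorem cap_func {n : ℕ} (f : L.Functions n) (ts : Fin n → L.Term V) :
    A.cap (A.resSort f) (.func f ts) = .func f fun i => A.cap (A.argSort f i) (ts i) := by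
  rw [cap, if_pos rfl]

variable {A} in
theorem cap_of_rootSort_ne {β : S} {s : L.Term V} (h : A.rootSort s ≠ some β) :
    A.cap β s = .var (β, s) := by
  cases s with
  | var x => rw [cap]
  | func f ts => rw [cap, if_neg (mt (congrArg some) h)]

theorem cap_subst_snd (β : S) (s : L.Term V) : (A.cap β s).subst Prod.snd = s := by
  induction β, s using A.slot_induction with
  | alien β s hs => rw [cap_of_rootSort_ne hs, Term.subst]
  | func f ts ih =>
    rw [cap_func]
    exact congrArg (Term.func f) (funext ih)

variable {A} in
theorem HasSort.cap_subst {p : L.Term V} {α : S} (hp : A.HasSort p α) (σ : V → L.Term V) :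
    A.cap α (p.subst σ) = p.subst fun y => A.cap (A.varSort y) (σ y) := by
  induction hp with
  | var x => rfl
  | func f ts _ ih =>
    rw [Term.subst, cap_func]
    exact congrArg (Term.func f) (funext ih)

theorem cap_cap_subst (β : S) (s : L.Term V) (b : S × L.Term V → L.Term V) :
    A.cap β ((A.cap β s).subst b) = (A.cap β s).subst fun h => A.cap h.1 (b h) := by
  induction β, s using A.slot_induction with
  | alien β s hs => simp only [cap_of_rootSort_ne hs, Term.subst]
  | func f ts ih =>
    simp only [cap_func, Term.subst]
    exact congrArg (Term.func f) (funext ih)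

theorem hasSort_cap_subst (b : S × L.Term V → L.Term V) (hb : ∀ h, A.HasSort (b h) h.1)
    (β : S) (s : L.Term V) : A.HasSort ((A.cap β s).subst b) β := by
  induction β, s using A.slot_induction with
  | alien β s hs =>
    rw [cap_of_rootSort_ne hs]
    exact hb (β, s)
  | func f ts ih =>
    rw [cap_func]
    exact .func f _ ih

variable {A} in
theorem mem_aliens_of_rootSort_ne {β : S} {s : L.Term V} (hs : A.rootSort s ≠ some β)
    {h : S × L.Term V} : h ∈ A.aliens β s ↔ h = (β, s) := by
  classical rw [aliens, cap_of_rootSort_ne hs, Term.varFinset, Finset.mem_singleton]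

variable {A} in
theorem mem_aliens_func {n : ℕ} {f : L.Functions n} {ts : Fin n → L.Term V}
    {h : S × L.Term V} :
    h ∈ A.aliens (A.resSort f) (.func f ts) ↔ ∃ i, h ∈ A.aliens (A.argSort f i) (ts i) := by
  classical
  rw [aliens, cap_func, mem_varFinset_func]
  rfl

open Classical in
variable {A} in
theorem HasSort.mem_aliens_subst {p : L.Term V} {α : S} (hp : A.HasSort p α)
    {σ : V → L.Term V} {h : S × L.Term V} :
    h ∈ A.aliens α (p.subst σ) ↔ ∃ y ∈ p.varFinset, h ∈ A.aliens (A.varSort y) (σ y) := by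
  rw [aliens, hp.cap_subst, mem_varFinset_subst]
  rfl

variable {A} in
theorem mem_aliens_cap_subst {β : S} {s : L.Term V} {b : S × L.Term V → L.Term V}
    {h : S × L.Term V} :
    h ∈ A.aliens β ((A.cap β s).subst b) ↔ ∃ k ∈ A.aliens β s, h ∈ A.aliens k.1 (b k) := by
  classical
  rw [aliens, cap_cap_subst, mem_varFinset_subst]
  rfl

variable {A} in
theorem rootSort_ne_of_mem_aliens {β : S} {s : L.Term V} {h : S × L.Term V}
    (hh : h ∈ A.aliens β s) : A.rootSort h.2 ≠ some h.1 := by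
  induction β, s using A.slot_induction with
  | alien β s hs =>
    rw [(mem_aliens_of_rootSort_ne hs).1 hh]
    exact hs
  | func f ts ih =>
    obtain ⟨i, hi⟩ := mem_aliens_func.1 hh
    exact ih i hi

theorem reduces_cap_subst {R : TRS L V} {β : S} {s : L.Term V} {b : S × L.Term V → L.Term V}
    (hb : ∀ h ∈ A.aliens β s, ReflTransGen R.Step h.2 (b h)) :
    ReflTransGen R.Step s ((A.cap β s).subst b) := by
  classical
  have := TRS.reduces_subst (A.cap β s) (σ := Prod.snd) (τ := b) hb
  rwa [cap_subst_snd] at this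

end Caps

section Rank

variable (A : SortAttachment L V S)

open Classical in
/-- The rank of a term that stands in a slot of sort `β`: the maximal number of changes of sort on
a path from the slot to a leaf, where reaching a variable counts as a change. -/
noncomputable def rank : S → L.Term V → ℕ
  | _, .var _ => 1
  | β, .func f ts =>
    (Finset.univ.sup fun i => rank (A.argSort f i) (ts i)) + if A.resSort f = β then 0 else 1

theorem rank_func_le_iff {n : ℕ} {f : L.Functions n} {ts : Fin n → L.Term V} {k : ℕ} :
    A.rank (A.resSort f) (.func f ts) ≤ k ↔ ∀ i, A.rank (A.argSort f i) (ts i) ≤ k := by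
  rw [rank, if_pos rfl, add_zero, Finset.sup_le_iff]
  simp only [Finset.mem_univ, true_imp_iff]

theorem rank_le_iff_forall_aliens {β : S} {s : L.Term V} {k : ℕ} :
    A.rank β s ≤ k ↔ ∀ h ∈ A.aliens β s, A.rank h.1 h.2 ≤ k := by
  induction β, s using A.slot_induction with
  | alien β s hs => simp only [mem_aliens_of_rootSort_ne hs, forall_eq]
  | func f ts ih =>
    simp only [rank_func_le_iff, ih, mem_aliens_func]
    exact ⟨fun H h ⟨i, hi⟩ => H i h hi, fun H i h hi => H h ⟨i, hi⟩⟩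

theorem rank_le_rank_add_one (α β : S) (s : L.Term V) : A.rank β s ≤ A.rank α s + 1 := by
  cases s with
  | var x => simp only [rank, Nat.reduceAdd, Nat.one_le_ofNat]
  | func f ts => grind [rank]

variable {A}

theorem rank_eq_rank_add_one {α β : S} {s : L.Term V} (hs : A.rootSort s = some α)
    (hne : α ≠ β) : A.rank β s = A.rank α s + 1 := by
  cases s with
  | var x => cases hs
  | func f ts =>
    cases hs
    rw [rank, rank, if_neg hne, if_pos rfl]

theorem rank_le_of_rootSort_eq {β : S} {s : L.Term V} (hs : A.rootSort s = some β) (α : S) :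
    A.rank β s ≤ A.rank α s := by
  obtain rfl | hne := eq_or_ne β α
  · exact le_rfl
  · exact (Nat.le_succ _).trans (rank_eq_rank_add_one hs hne).ge

end Rank

section Steps

variable {A : SortAttachment L V S} {R : TRS L V}

/-- A rewrite step in a slot of sort `β`, whose contracted redex is located relative to the cap:
at a root whose sort fits the slot, in an argument below a function symbol of the cap, or in an
alien, which is then regarded in the slot of its own root sort. -/
inductive SlotStep (A : SortAttachment L V S) (R : TRS L V) : S → L.Term V → L.Term V → Prop
  | root {ℓ r : L.Term V} {α : S} (h : (ℓ, r) ∈ R.rules) (hℓ : A.HasSort ℓ α)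
      (hr : A.HasSort r α) (σ : V → L.Term V) : SlotStep A R α (ℓ.subst σ) (r.subst σ)
  | arg {n : ℕ} (f : L.Functions n) (ts : Fin n → L.Term V) (i : Fin n) (t : L.Term V)
      (h : SlotStep A R (A.argSort f i) (ts i) t) :
      SlotStep A R (A.resSort f) (.func f ts) (.func f (Function.update ts i t))
  | alien {α β : S} {s t : L.Term V} (hs : A.rootSort s = some α) (hne : α ≠ β)
      (h : SlotStep A R α s t) : SlotStep A R β s t

theorem SlotStep.step {β : S} {s t : L.Term V} (h : A.SlotStep R β s t) : R.Step s t := by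
  induction h with
  | root h _ _ σ => exact .root _ _ h σ
  | arg f ts i t _ ih => exact .arg f ts i t ih
  | alien _ _ _ ih => exact ih

theorem slotStep_of_step (hR : R.Compatible A) {s t : L.Term V} (h : R.Step s t) (β : S) :
    A.SlotStep R β s t := by
  have of_rootSort {α β : S} {s t : L.Term V} (hs : A.rootSort s = some α)
      (h : A.SlotStep R α s t) : A.SlotStep R β s t := by
    obtain rfl | hne := eq_or_ne α β
    · exact h
    · exact .alien hs hne h
  induction h generalizing β with
  | root ℓ r h σ =>
    obtain ⟨α, hℓ, hr⟩ := hR ℓ r h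
    exact of_rootSort (hℓ.rootSort_subst (R.lhs_not_var ℓ r h) σ) (.root h hℓ hr σ)
  | arg f ts i t _ ih => exact of_rootSort rfl (.arg f ts i t (ih _))

theorem aliens_subst_subset_of_rule {ℓ r : L.Term V} {α : S} (h : (ℓ, r) ∈ R.rules)
    (hℓ : A.HasSort ℓ α) (hr : A.HasSort r α) (σ : V → L.Term V) :
    A.aliens α (r.subst σ) ⊆ A.aliens α (ℓ.subst σ) := by
  intro k hk
  obtain ⟨y, hy, hk⟩ := hr.mem_aliens_subst.1 hk
  exact hℓ.mem_aliens_subst.2 ⟨y, R.vars_subset ℓ r h hy, hk⟩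

theorem rank_le_of_step (hR : R.Compatible A) {s t : L.Term V} (h : R.Step s t) (β : S) :
    A.rank β t ≤ A.rank β s := by
  replace h := slotStep_of_step hR h β
  induction h with
  | root h hℓ hr σ =>
    exact A.rank_le_iff_forall_aliens.2 fun k hk =>
      A.rank_le_iff_forall_aliens.1 le_rfl k (aliens_subst_subset_of_rule h hℓ hr σ hk)
  | arg f ts i t _ ih =>
    have hts := A.rank_func_le_iff.1 (le_refl (A.rank (A.resSort f) (.func f ts)))
    refine A.rank_func_le_iff.2 ((Function.forall_update_iff ts
      fun j u => A.rank (A.argSort f j) u ≤ _).2 ⟨?_, fun j _ => hts j⟩)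
    exact ih.trans (hts i)
  | @alien α β s t hs hne _ ih =>
    calc A.rank β t ≤ A.rank α t + 1 := A.rank_le_rank_add_one α β t
      _ ≤ A.rank α s + 1 := Nat.succ_le_succ ih
      _ = A.rank β s := (rank_eq_rank_add_one hs hne).symm

theorem rank_le_of_reduces (hR : R.Compatible A) {s t : L.Term V}
    (h : ReflTransGen R.Step s t) (β : S) : A.rank β t ≤ A.rank β s := by
  induction h with
  | refl => exact le_rfl
  | tail _ h ih => exact (rank_le_of_step hR h β).trans ih

theorem rank_lt_of_collapse (hR : R.Compatible A) {a a' : L.Term V} {γ : S}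
    (ha : A.rootSort a ≠ some γ) (h : ReflTransGen R.Step a a')
    (ha' : A.rootSort a' = some γ) : A.rank γ a' < A.rank γ a := by
  cases a with
  | var x =>
    rw [TRS.eq_var_of_reduces h] at ha'
    exact absurd ha' ha
  | func f ts =>
    calc A.rank γ a' ≤ A.rank (A.resSort f) a' := rank_le_of_rootSort_eq ha' _
      _ ≤ A.rank (A.resSort f) (.func f ts) := rank_le_of_reduces hR h _
      _ < A.rank γ (.func f ts) := by
        rw [rank_eq_rank_add_one (s := .func f ts) rfl (mt (congrArg some) ha)]
        exact Nat.lt_succ_self _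

theorem joinable_cap_subst_of_step (hR : R.Compatible A) {b : S × L.Term V → L.Term V}
    {s t : L.Term V} (h : R.Step s t) {β : S}
    (hb : ∀ k ∈ A.aliens β s, ∀ a, R.Step k.2 a →
      Joinable R.Step (b k) ((A.cap k.1 a).subst b)) :
    Joinable R.Step ((A.cap β s).subst b) ((A.cap β t).subst b) := by
  replace h := slotStep_of_step hR h β
  induction h with
  | root h hℓ hr σ =>
    rw [hℓ.cap_subst, hr.cap_subst, subst_subst, subst_subst]
    exact .of_reduces (.single (.root _ _ h _))
  | arg f ts i t _ ih =>
    have hi := ih fun k hk => hb k (mem_aliens_func.2 ⟨i, hk⟩)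
    simpa only [cap_func, Term.subst,
      Function.apply_update fun j u => (A.cap (A.argSort f j) u).subst b]
      using TRS.joinable_func_update f
        (ts := fun j => (A.cap (A.argSort f j) (ts j)).subst b) hi
  | @alien α β s t hs hne h =>
    have hs' : A.rootSort s ≠ some β := hs ▸ mt Option.some.inj hne
    rw [cap_of_rootSort_ne hs']
    exact hb (β, s) ((mem_aliens_of_rootSort_ne hs').2 rfl) t h.step

end Steps

section Stability

variable {A : SortAttachment L V S} {R : TRS L V}

/-- A stable alien of a slot of sort `β`: it is confluent and none of its reducts merges with the
cap around the slot. -/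
def Stable (A : SortAttachment L V S) (R : TRS L V) (β : S) (a : L.Term V) : Prop :=
  ConfluentAt R.Step a ∧ ∀ b, ReflTransGen R.Step a b → A.rootSort b ≠ some β

/-- All aliens of the term, in a slot of sort `β`, are stable, so that its cap can only change by
steps of the cap. -/
def StableAliens (A : SortAttachment L V S) (R : TRS L V) (β : S) (s : L.Term V) : Prop :=
  ∀ h ∈ A.aliens β s, A.Stable R h.1 h.2

theorem Stable.of_reduces {β : S} {a b : L.Term V} (h : A.Stable R β a)
    (hab : ReflTransGen R.Step a b) : A.Stable R β b :=
  ⟨h.1.of_reduces hab, fun c hc => h.2 c (hab.trans hc)⟩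

theorem StableAliens.exists_mem_aliens_of_step (hR : R.Compatible A) {β : S} {s t : L.Term V}
    (hs : A.StableAliens R β s) (hst : R.Step s t) {γ : S} {a : L.Term V}
    (ha : (γ, a) ∈ A.aliens β t) : ∃ c, (γ, c) ∈ A.aliens β s ∧ ReflTransGen R.Step c a := by
  replace hst := slotStep_of_step hR hst β
  induction hst with
  | root h hℓ hr σ => exact ⟨a, aliens_subst_subset_of_rule h hℓ hr σ ha, .refl⟩
  | arg f ts i t _ ih =>
    obtain ⟨j, hj⟩ := mem_aliens_func.1 ha
    obtain rfl | hji := eq_or_ne j i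
    · rw [Function.update_self] at hj
      obtain ⟨c, hc, hca⟩ := ih (fun k hk => hs k (mem_aliens_func.2 ⟨j, hk⟩)) hj
      exact ⟨c, mem_aliens_func.2 ⟨j, hc⟩, hca⟩
    · rw [Function.update_of_ne hji] at hj
      exact ⟨a, mem_aliens_func.2 ⟨j, hj⟩, .refl⟩
  | @alien α β s t hroot hne h =>
    have hmem : (β, s) ∈ A.aliens β s :=
      (mem_aliens_of_rootSort_ne (hroot ▸ mt Option.some.inj hne)).2 rfl
    have ht : A.rootSort t ≠ some β := (hs _ hmem).2 t (.single h.step)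
    cases (mem_aliens_of_rootSort_ne ht).1 ha
    exact ⟨s, hmem, .single h.step⟩

theorem StableAliens.of_step (hR : R.Compatible A) {β : S} {s t : L.Term V}
    (hs : A.StableAliens R β s) (hst : R.Step s t) : A.StableAliens R β t := by
  intro h hh
  obtain ⟨c, hc, hca⟩ := hs.exists_mem_aliens_of_step hR hst hh
  exact (hs _ hc).of_reduces hca

theorem StableAliens.of_reduces (hR : R.Compatible A) {β : S} {s t : L.Term V}
    (hs : A.StableAliens R β s) (hst : ReflTransGen R.Step s t) : A.StableAliens R β t := by
  induction hst with
  | refl => exact hs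
  | tail _ h ih => exact ih.of_step hR h

theorem StableAliens.exists_mem_aliens_of_reduces (hR : R.Compatible A) {β : S}
    {s t : L.Term V} (hs : A.StableAliens R β s) (hst : ReflTransGen R.Step s t) {γ : S}
    {a : L.Term V} (ha : (γ, a) ∈ A.aliens β t) :
    ∃ c, (γ, c) ∈ A.aliens β s ∧ ReflTransGen R.Step c a := by
  induction hst generalizing a with
  | refl => exact ⟨a, ha, .refl⟩
  | tail hsu hut ih =>
    obtain ⟨d, hd, hda⟩ := (hs.of_reduces hR hsu).exists_mem_aliens_of_step hR hut ha
    obtain ⟨c, hc, hcd⟩ := ih hd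
    exact ⟨c, hc, hcd.trans hda⟩

variable (A) in
theorem exists_sorted_class_variables {α : Type*} {r : α → α → Prop} {F : Set α}
    (hF : F.Finite) (hconf : ∀ c ∈ F, ConfluentAt r c) :
    ∃ ξ : S → α → V, (∀ γ a, A.varSort (ξ γ a) = γ) ∧
      (∀ γ a b, ConfluentAt r a → r a b → ξ γ a = ξ γ b) ∧
      ∀ γ a b c, c ∈ F → ReflTransGen r c a → ξ γ a = ξ γ b → Joinable r a b := by
  -- A joinability class is encoded by its members in `F`.
  let members (a : α) : Set α := {c ∈ F | Joinable r a c}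
  have members_mem (a : α) : members a ∈ 𝒫 F := Set.sep_subset _ _
  have code (γ : S) : ∃ ν : Set α → V, 𝒫 F ⊆ ν ⁻¹' {x | A.varSort x = γ} ∧ Set.InjOn ν (𝒫 F) := by
    have : Nonempty V := (A.vars_infinite γ).nonempty.to_type
    refine hF.finite_subsets.exists_injOn_of_encard_le ?_
    rw [(A.vars_infinite γ).encard_eq]
    exact le_top
  choose ν hsort hinj using code
  refine ⟨fun γ a => ν γ (members a), fun γ a => hsort γ (members_mem a), ?_, ?_⟩
  · intro γ a b ha hab
    simp only [members, ha.joinable_congr_left (.single hab)]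
  · intro γ a b c hc hca hab
    have hac : c ∈ members a := ⟨hc, (Joinable.of_reduces hca).symm⟩
    have hbc : c ∈ members b := hinj γ (members_mem a) (members_mem b) hab ▸ hac
    exact (hconf c hc).joinable_trans hac.2 hbc.2.symm

theorem StableAliens.joinable_cap_subst_var (hR : R.Compatible A)
    (hconf : ConfluentOn R.Step A.sortedTerms) {ξ : S → L.Term V → V}
    (ξ_sort : ∀ γ a, A.varSort (ξ γ a) = γ)
    (ξ_step : ∀ γ a b, ConfluentAt R.Step a → R.Step a b → ξ γ a = ξ γ b) {β : S}
    {s t₁ t₂ : L.Term V} (hs : A.StableAliens R β s) (hst₁ : ReflTransGen R.Step s t₁)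
    (hst₂ : ReflTransGen R.Step s t₂) :
    Joinable R.Step ((A.cap β t₁).subst fun h => .var (ξ h.1 h.2))
      ((A.cap β t₂).subst fun h => .var (ξ h.1 h.2)) := by
  refine joinable_map_of_reduces (fun t => (A.cap β t).subst fun h => .var (ξ h.1 h.2))
    (fun t _ => hconf.confluentAt ⟨β, ?_⟩)
    (fun t t' hst htt' => joinable_cap_subst_of_step hR htt' fun k hk a hka => ?_) hst₁ hst₂
  · refine A.hasSort_cap_subst _ (fun h => ?_) β t
    simpa only [ξ_sort] using HasSort.var (A := A) (ξ h.1 h.2)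
  · have hk := hs.of_reduces hR hst k hk
    rw [cap_of_rootSort_ne (hk.2 a (.single hka)), ξ_step _ _ _ hk.1 hka]
    exact .refl _

theorem StableAliens.confluentAt (hR : R.Compatible A) (hconf : ConfluentOn R.Step A.sortedTerms)
    {β : S} {s : L.Term V} (hs : A.StableAliens R β s) : ConfluentAt R.Step s := by
  obtain ⟨ξ, ξ_sort, ξ_step, ξ_join⟩ := A.exists_sorted_class_variables (r := R.Step)
    (F := Prod.snd '' (A.aliens β s : Set (S × L.Term V))) ((Finset.finite_toSet _).image _)
    (by rintro _ ⟨h, hh, rfl⟩; exact (hs h hh).1)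
  intro t₁ t₂ hst₁ hst₂
  have abstractions_joinable := hs.joinable_cap_subst_var hR hconf ξ_sort ξ_step hst₁ hst₂
  have : Nonempty (L.Term V) := ⟨s⟩
  obtain ⟨w, hw⟩ : ∃ w : V → L.Term V, ∀ h ∈ {h | h ∈ A.aliens β t₁} ∪ {h | h ∈ A.aliens β t₂},
      ReflTransGen R.Step h.2 (w (ξ h.1 h.2)) := by
    have origin : ∀ h ∈ {h | h ∈ A.aliens β t₁} ∪ {h | h ∈ A.aliens β t₂},
        ∃ c, (h.1, c) ∈ A.aliens β s ∧ ReflTransGen R.Step c h.2 := by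
      rintro h (hh | hh)
      · exact hs.exists_mem_aliens_of_reduces hR hst₁ hh
      · exact hs.exists_mem_aliens_of_reduces hR hst₂ hh
    refine exists_common_reduct_on_fibers
      ((Finset.finite_toSet _).union (Finset.finite_toSet _)) Prod.snd _ ?_ ?_
    · intro h hh
      obtain ⟨c, hc, hch⟩ := origin h hh
      exact (hs _ hc).1.of_reduces hch
    · intro h hh k _ hhk
      obtain ⟨c, hc, hch⟩ := origin h hh
      have hsort : h.1 = k.1 := by rw [← ξ_sort h.1 h.2, hhk, ξ_sort]
      exact ξ_join h.1 _ _ c ⟨_, hc, rfl⟩ hch (hsort ▸ hhk)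
  refine (abstractions_joinable.map _ fun _ _ h => h.subst w).of_reduces_of_reduces ?_ ?_ <;>
    rw [subst_subst]
  · exact A.reduces_cap_subst fun h hh => hw h (.inl hh)
  · exact A.reduces_cap_subst fun h hh => hw h (.inr hh)

end Stability

section RankInduction

variable {A : SortAttachment L V S} {R : TRS L V} {n : ℕ}

theorem confluentAt_of_rootSort_ne (hn : ∀ β s, A.rank β s < n → ConfluentAt R.Step s) {γ : S}
    {a : L.Term V} (ha : A.rootSort a ≠ some γ) (hrank : A.rank γ a ≤ n) :
    ConfluentAt R.Step a := by
  cases a with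
  | var x => exact TRS.confluentAt_var x
  | func f ts =>
    rw [rank_eq_rank_add_one (s := .func f ts) rfl (mt (congrArg some) ha)] at hrank
    exact hn _ _ hrank

theorem exists_reduct_stableAliens (hR : R.Compatible A)
    (hn : ∀ β s, A.rank β s < n → ConfluentAt R.Step s) {γ : S} {a : L.Term V}
    (ha : A.rootSort a ≠ some γ) (hrank : A.rank γ a ≤ n) :
    ∃ c, ReflTransGen R.Step a c ∧ A.StableAliens R γ c := by
  induction hk : A.rank γ a using Nat.strong_induction_on generalizing γ a with
  | _ k ih =>
  by_cases hcollapse : ∃ a', ReflTransGen R.Step a a' ∧ A.rootSort a' = some γ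
  · obtain ⟨a', haa', ha'⟩ := hcollapse
    have reduct (h : S × L.Term V) : ∃ c, h ∈ A.aliens γ a' →
        ReflTransGen R.Step h.2 c ∧ A.StableAliens R h.1 c := by
      by_cases hh : h ∈ A.aliens γ a'
      · have hlt : A.rank h.1 h.2 < A.rank γ a :=
          (A.rank_le_iff_forall_aliens.1 le_rfl h hh).trans_lt (rank_lt_of_collapse hR ha haa' ha')
        obtain ⟨c, hc⟩ := ih _ (hk ▸ hlt) (rootSort_ne_of_mem_aliens hh) (hlt.le.trans hrank) rfl
        exact ⟨c, fun _ => hc⟩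
      · exact ⟨h.2, fun hh' => absurd hh' hh⟩
    choose b hb using reduct
    refine ⟨(A.cap γ a').subst b, haa'.trans (A.reduces_cap_subst fun h hh => (hb h hh).1), ?_⟩
    intro h hh
    obtain ⟨k, hk, hh⟩ := mem_aliens_cap_subst.1 hh
    exact (hb k hk).2 h hh
  · refine ⟨a, .refl, fun h hh => ?_⟩
    rw [(mem_aliens_of_rootSort_ne ha).1 hh]
    exact ⟨confluentAt_of_rootSort_ne hn ha hrank, fun b hab hb => hcollapse ⟨b, hab, hb⟩⟩

theorem confluentAt_of_rank_le (hR : R.Compatible A) (hconf : ConfluentOn R.Step A.sortedTerms)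
    (hn : ∀ β s, A.rank β s < n → ConfluentAt R.Step s) {β : S} {s : L.Term V}
    (hs : A.rank β s ≤ n) : ConfluentAt R.Step s := by
  have reduct (h : S × L.Term V) : ∃ c, ReflTransGen R.Step h.2 c ∧
      (A.rootSort h.2 ≠ some h.1 → A.rank h.1 h.2 ≤ n → A.StableAliens R h.1 c) := by
    by_cases hh : A.rootSort h.2 ≠ some h.1 ∧ A.rank h.1 h.2 ≤ n
    · obtain ⟨c, hc, hstable⟩ := exists_reduct_stableAliens hR hn hh.1 hh.2
      exact ⟨c, hc, fun _ _ => hstable⟩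
    · exact ⟨h.2, .refl, fun h₁ h₂ => absurd ⟨h₁, h₂⟩ hh⟩
  choose b reduces_b stable_b using reduct
  let stabilize (t : L.Term V) : L.Term V := (A.cap β t).subst b
  have reduces_stabilize (γ : S) (t : L.Term V) :
      ReflTransGen R.Step t ((A.cap γ t).subst b) :=
    A.reduces_cap_subst fun h _ => reduces_b h
  have rank_alien {t : L.Term V} (hst : ReflTransGen R.Step s t) {h : S × L.Term V}
      (hh : h ∈ A.aliens β t) : A.rank h.1 h.2 ≤ n :=
    A.rank_le_iff_forall_aliens.1 ((rank_le_of_reduces hR hst β).trans hs) h hh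
  intro t₁ t₂ hst₁ hst₂
  refine Joinable.of_reduces_of_reduces (reduces_stabilize β t₁) (reduces_stabilize β t₂)
    (joinable_map_of_reduces stabilize (fun t hst => ?_) (fun t t' hst htt' => ?_) hst₁ hst₂)
  · have stable : A.StableAliens R β (stabilize t) := fun h hh => by
      obtain ⟨k, hk, hh⟩ := mem_aliens_cap_subst.1 hh
      exact stable_b k (rootSort_ne_of_mem_aliens hk) (rank_alien hst hk) h hh
    exact stable.confluentAt hR hconf
  · refine joinable_cap_subst_of_step hR htt' fun k hk a hka => ?_
    have alien_confluent : ConfluentAt R.Step k.2 :=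
      confluentAt_of_rootSort_ne hn (rootSort_ne_of_mem_aliens hk) (rank_alien hst hk)
    exact alien_confluent _ _ (reduces_b k) (.head hka (reduces_stabilize k.1 a))

end RankInduction

theorem nonempty_sort (A : SortAttachment L V S) : L.Term V → Nonempty S
  | .var x => ⟨A.varSort x⟩
  | .func f _ => ⟨A.resSort f⟩

end SortAttachment

end TermRewriting

theorem mainTheorem10_general {L : FirstOrder.Language.{u, v}} {V : Type w} {S : Type z}
    (A : TermRewriting.SortAttachment L V S) (R : TermRewriting.TRS L V) (hR : R.Compatible A)
    (hconf : TermRewriting.ConfluentOn R.Step A.sortedTerms) :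
    TermRewriting.Confluent R.Step := by
  have by_rank (n : ℕ) : ∀ β s, A.rank β s = n → TermRewriting.ConfluentAt R.Step s := by
    induction n using Nat.strong_induction_on with
    | _ n ih =>
      intro β s hs
      exact TermRewriting.SortAttachment.confluentAt_of_rank_le hR hconf
        (fun γ a ha => ih _ ha γ a rfl) hs.le
  intro s
  obtain ⟨β⟩ := A.nonempty_sort s
  exact by_rank _ β s rfl

theorem mainTheorem10 {L : FirstOrder.Language.{u, v}} {V : Type w} [Countable V] [Infinite V]
    {S : Type z} (A : TermRewriting.SortAttachment L V S) (R : TermRewriting.TRS L V)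
    (hR : R.Compatible A)
    (hconf : TermRewriting.ConfluentOn R.Step A.sortedTerms) :
    TermRewriting.Confluent R.Step :=
  mainTheorem10_general A R hR hconf
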